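/- Let $M$ be the simple matroid of rank $3$ on the ground set $\{0,1,\dots,12\}$ whose rank-two flats with more than two elements are exactly $$\begin{array}{lllll} \{0,3,9\}, & \{0,4,7\}, & \{0,5,6\}, & \{8,9,10\}, & \{7,10,11\},\\ \{1,4,9\}, & \{1,3,7\}, & \{1,5,8\}, & \{6,9,11\}, & \{6,10,12\},\\ \{2,5,9\}, & \{2,3,6\}, & \{2,4,8\}, & \{7,9,12\}, & \{8,11,12\}. \end{array}$$ Let $\mathbb K$ be any field, $V$ a finite-dimensional $\mathbb K$-vector space, and $\mathcal A$ a finite set of linear hyperplanes in $V$. For each $H\in\mathcal A$ choose a linear form $\alpha_H\in V^*$ with $\ker\alpha_H=H$. The underlying matroid of $\mathcal A$ is the matroid on $\mathcal A$ in which a subset is independent if and only if the corresponding forms $\alpha_H$ are linearly independent. The arrangement $\mathcal A$ is called formal if the kernel of the linear map $\Phi:\mathbb K^{\mathcal A}\to V^*$, $e_H\mapsto\alpha_H$, is spanned by its elements with at most three nonzero entries. (Neither notion depends on the choice of the forms $\alpha_H$.) Then: if the underlying matroid of $\mathcal A$ is isomorphic to $M$, the arrangement $\mathcal A$ is formal.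 -/

import Mathlib

/-- The matroid on a finite type `ι` that is realized by a family of vectors `v : ι → W`:
the ground set is all of `ι`, and `I` is independent iff `(v i)_{i ∈ I}` is linearly independent. -/
def linearMatroid (K : Type*) [Field K] {W : Type*} [AddCommGroup W] [Module K W]
    {ι : Type*} [Finite ι] (v : ι → W) : Matroid ι :=
  (IndepMatroid.ofFinite (E := Set.univ) Set.finite_univ
    (fun I => LinearIndepOn K v I)
    (linearIndepOn_empty K v)
    (fun _ _ hJ hIJ => hJ.mono hIJ)
    (by
      intro I J hI hJ hlt
      by_contra! hcon
      have hsub : v '' J ⊆ Submodule.span K (v '' I) := by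
        rintro _ ⟨e, he, rfl⟩
        by_contra hns
        obtain ⟨h1, h2⟩ := hI.notMem_span_iff.1 hns
        exact hcon e he h2 h1
      have hle : Submodule.span K (v '' J) ≤ Submodule.span K (v '' I) :=
        Submodule.span_le.2 hsub
      have hfin : (v '' I).Finite := Set.toFinite _
      have : FiniteDimensional K (Submodule.span K (v '' I)) :=
        FiniteDimensional.span_of_finite K hfin
      have h3 := Submodule.finrank_mono hle
      have key : ∀ S : Set ι, LinearIndepOn K v S →
          Module.finrank K (Submodule.span K (v '' S)) = S.ncard := by
        intro S hS
        have : Fintype S := Fintype.ofFinite S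
        have h4 := finrank_span_eq_card hS
        rw [← Set.image_eq_range] at h4
        rw [h4, ← Nat.card_eq_fintype_card, Nat.card_coe_set_eq]
      rw [key I hI, key J hJ] at h3
      omega)
    (fun _ _ => Set.subset_univ _)).matroid

theorem linearMatroid_indep_iff {K : Type*} [Field K] {W : Type*} [AddCommGroup W] [Module K W]
    {ι : Type*} [Finite ι] (v : ι → W) (I : Set ι) :
    (linearMatroid K v).Indep I ↔ LinearIndepOn K v I := by
  simp [linearMatroid, IndepMatroid.ofFinite, IndepMatroid.ofBddAugment, IndepMatroid.ofBdd]

/-- A (central) arrangement in `V`: a finite set of linear hyperplanes, i.e. of linear subspaces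
of codimension one (maximal proper subspaces). -/
structure HyperplaneArrangement (K V : Type*) [Field K] [AddCommGroup V] [Module K V] where
  hyperplanes : Finset (Submodule K V)
  isCoatom : ∀ H ∈ hyperplanes, IsCoatom H

namespace HyperplaneArrangement

variable {K V : Type*} [Field K] [AddCommGroup V] [Module K V]

/-- `α` is a choice of defining linear forms: `ker α_H = H` for every hyperplane `H` of `A`. -/
def IsDefiningForms (A : HyperplaneArrangement K V)
    (α : A.hyperplanes → Module.Dual K V) : Prop :=
  ∀ H : A.hyperplanes, LinearMap.ker (α H) = (H : Submodule K V)

/-- `A` realizes `M`: the matroid of a system of defining forms of `A` is equal to `M` after a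
bijective labelling of the hyperplanes. Here `M` is a matroid whose ground set is all of `ι`. -/
def Realizes (A : HyperplaneArrangement K V) {ι : Type*} (M : Matroid ι) : Prop :=
  ∃ α : A.hyperplanes → Module.Dual K V, A.IsDefiningForms α ∧
    ∃ e : ι ≃ A.hyperplanes, linearMatroid K α = M.mapEquiv e

/-- The kernel of the map `Φ : K^A → V*`, `e_H ↦ α_H`: the linear relations among the forms. -/
noncomputable def relationSpace (A : HyperplaneArrangement K V)
    (α : A.hyperplanes → Module.Dual K V) : Submodule K (A.hyperplanes →₀ K) :=
  LinearMap.ker (Finsupp.linearCombination K α)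

/-- The subspace `F ⊆ ker Φ` generated by the relations with at most three nonzero entries. -/
noncomputable def shortRelationSpace (A : HyperplaneArrangement K V)
    (α : A.hyperplanes → Module.Dual K V) : Submodule K (A.hyperplanes →₀ K) :=
  Submodule.span K {y | y ∈ A.relationSpace α ∧ y.support.card ≤ 3}

/-- `A` is formal: the relations with at most three nonzero entries generate all relations. (Forms
are unique up to nonzero scalars, so this does not depend on the choice of `α`.) -/
def IsFormal (A : HyperplaneArrangement K V) : Prop :=
  ∀ α : A.hyperplanes → Module.Dual K V, A.IsDefiningForms α →
    A.shortRelationSpace α = A.relationSpace α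

end HyperplaneArrangement

/-- The fifteen nontrivial lines (rank-two flats with more than two elements) of `matroidM`. -/
def linesM : Finset (Finset (Fin 13)) :=
  { {0, 3, 9}, {0, 4, 7}, {0, 5, 6}, {8, 9, 10}, {7, 10, 11},
    {1, 4, 9}, {1, 3, 7}, {1, 5, 8}, {6, 9, 11}, {6, 10, 12},
    {2, 5, 9}, {2, 3, 6}, {2, 4, 8}, {7, 9, 12}, {8, 11, 12} }

theorem card_of_mem_linesM : ∀ L ∈ linesM, L.card = 3 := by
  simp only [linesM, Finset.forall_mem_insert, Finset.mem_singleton, forall_eq]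
  refine ⟨?_, ?_, ?_, ?_, ?_, ?_, ?_, ?_, ?_, ?_, ?_, ?_, ?_, ?_, ?_⟩ <;> decide

theorem card_inter_linesM : ∀ L ∈ linesM, ∀ L' ∈ linesM, L ≠ L' → (L ∩ L').card ≤ 1 := by
  simp only [linesM, Finset.forall_mem_insert, Finset.mem_singleton, forall_eq]
  refine ⟨?_, ?_, ?_, ?_, ?_, ?_, ?_, ?_, ?_, ?_, ?_, ?_, ?_, ?_, ?_⟩ <;>
  refine ⟨?_, ?_, ?_, ?_, ?_, ?_, ?_, ?_, ?_, ?_, ?_, ?_, ?_, ?_, ?_⟩ <;> decide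

/-- The simple rank-three matroid on `{0, …, 12}` whose nontrivial lines are those in `linesM`.
As these all have three elements, a set is independent iff it has at most three elements and is
not one of them. -/
def matroidM : Matroid (Fin 13) :=
  (IndepMatroid.ofFinset (E := Set.univ)
    (fun I : Finset (Fin 13) => I.card ≤ 3 ∧ I ∉ linesM)
    (by decide)
    (by
      rintro I J ⟨hJ, hJL⟩ hIJ
      refine ⟨(Finset.card_le_card hIJ).trans hJ, fun hI => hJL ?_⟩
      have h3 := card_of_mem_linesM I hI
      rwa [← Finset.eq_of_subset_of_card_le hIJ (by omega)])
    (by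
      rintro I J ⟨hI, hIL⟩ ⟨hJ, hJL⟩ hlt
      by_contra! hcon
      have hline : ∀ e ∈ J, e ∉ I → insert e I ∈ linesM := by
        intro e he heI
        by_contra hn
        have hcd : (insert e I).card ≤ 3 := by
          rw [Finset.card_insert_of_notMem heI]; omega
        exact hn (hcon e he heI hcd)
      obtain ⟨e, he, heI⟩ := Finset.exists_mem_notMem_of_card_lt_card hlt
      have hL := hline e he heI
      have hc := card_of_mem_linesM _ hL
      rw [Finset.card_insert_of_notMem heI] at hc
      have hsub : J ⊆ insert e I := by
        intro d hd
        by_contra hdn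
        have hdI : d ∉ I := fun h => hdn (Finset.mem_insert_of_mem h)
        have hne : insert e I ≠ insert d I := fun h =>
          hdn (h ▸ Finset.mem_insert_self d I)
        have h1 := card_inter_linesM _ hL _ (hline d hd hdI) hne
        have h2 : I ⊆ insert e I ∩ insert d I :=
          Finset.subset_inter (Finset.subset_insert _ _) (Finset.subset_insert _ _)
        have := Finset.card_le_card h2
        omega
      have hJe : J = insert e I := Finset.eq_of_subset_of_card_le hsub (by
        rw [Finset.card_insert_of_notMem heI]; omega)
      exact hJL (hJe ▸ hL))
    (fun _ _ => Set.subset_univ _)).matroid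

theorem matroidM_indep_iff (I : Finset (Fin 13)) :
    matroidM.Indep (I : Set (Fin 13)) ↔ I.card ≤ 3 ∧ I ∉ linesM := by
  simp [matroidM, IndepMatroid.ofFinset_indep]

/-- `matroidM` is simple: every set with at most two elements is independent. -/
theorem matroidM_indep_pair (a b : Fin 13) : matroidM.Indep {a, b} := by
  have h := (matroidM_indep_iff {a, b}).2 ⟨Finset.card_le_two.trans (by norm_num), fun h => by
    have h1 := card_of_mem_linesM _ h
    have h2 : ({a, b} : Finset (Fin 13)).card ≤ 2 := Finset.card_le_two
    omega⟩
  simpa using h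

/-- `matroidM` has rank three. -/
theorem matroidM_eRank : matroidM.eRank = 3 := by
  have h := (matroidM_indep_iff {0, 1, 2}).2 (by decide)
  apply le_antisymm
  · obtain ⟨B, hB⟩ := matroidM.exists_isBase
    have hBi := hB.indep
    rw [← hB.encard_eq_eRank]
    lift B to Finset (Fin 13) using Set.toFinite B
    rw [Set.encard_coe_eq_coe_finsetCard]
    exact_mod_cast ((matroidM_indep_iff B).1 hBi).1
  · have := h.encard_le_eRank
    rw [Set.encard_coe_eq_coe_finsetCard] at this
    exact this

/-- The rank-two flats of `matroidM` with more than two elements are exactly those in `linesM`. -/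
theorem matroidM_nontrivial_lines (F : Finset (Fin 13)) :
    (matroidM.IsFlat F ∧ matroidM.eRk F = 2 ∧ 2 < F.card) ↔ F ∈ linesM := by
  have hE : matroidM.E = Set.univ := rfl
  have big : ∀ X : Finset (Fin 13), matroidM.eRk X = 2 → ∀ T ⊆ X, T.card = 3 → T ∈ linesM := by
    intro X hX T hT hc
    by_contra hn
    have hi := (matroidM_indep_iff T).2 ⟨hc.le, hn⟩
    have h1 := hi.encard_le_eRk_of_subset (Finset.coe_subset.2 hT)
    rw [Set.encard_coe_eq_coe_finsetCard, hX, hc] at h1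
    exact absurd h1 (by decide)
  have rk : ∀ L ∈ linesM, matroidM.eRk (L : Set (Fin 13)) = 2 := by
    intro L hL
    have hc := card_of_mem_linesM L hL
    apply le_antisymm
    · obtain ⟨I, hI⟩ := matroidM.exists_isBasis (L : Set (Fin 13)) (by simp [hE])
      have hIs := hI.subset
      have hIi := hI.indep
      rw [← hI.encard_eq_eRk]
      lift I to Finset (Fin 13) using Set.toFinite I
      have hne : I ≠ L := fun h => ((matroidM_indep_iff I).1 hIi).2 (h ▸ hL)
      have := Finset.card_lt_card
        ((Finset.coe_subset.1 hIs).ssubset_of_ne hne)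
      rw [Set.encard_coe_eq_coe_finsetCard]
      have h2 : I.card ≤ 2 := by omega
      exact_mod_cast h2
    · obtain ⟨a, b, c, hab, -, -, rfl⟩ := Finset.card_eq_three.1 hc
      have h1 := (matroidM_indep_pair a b).encard_le_eRk_of_subset
        (X := (({a, b, c} : Finset (Fin 13)) : Set (Fin 13))) (by
          intro x hx; simp at hx ⊢; tauto)
      rwa [Set.encard_pair hab] at h1
  have mem : ∀ X : Finset (Fin 13), matroidM.eRk X = 2 → ∀ L ∈ linesM, L ⊆ X → X ⊆ L := by
    intro X hX L hL hLX d hd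
    by_contra hdL
    obtain ⟨a, b, c, hab, hac, hbc, rfl⟩ := Finset.card_eq_three.1 (card_of_mem_linesM L hL)
    simp only [Finset.mem_insert, Finset.mem_singleton, not_or] at hdL
    have h1 := big X hX {a, b, d} (by
      intro x hx
      simp only [Finset.mem_insert, Finset.mem_singleton] at hx
      rcases hx with rfl | rfl | rfl
      · exact hLX (by simp)
      · exact hLX (by simp)
      · exact hd) (Finset.card_eq_three.2 ⟨a, b, d, hab, Ne.symm hdL.1, Ne.symm hdL.2.1, rfl⟩)
    have h2 := card_inter_linesM _ hL _ h1 (fun h => by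
      have : d ∈ ({a, b, c} : Finset (Fin 13)) := h ▸ (by simp)
      simp only [Finset.mem_insert, Finset.mem_singleton] at this
      tauto)
    have h3 : ({a, b} : Finset (Fin 13)) ⊆ {a, b, c} ∩ {a, b, d} := by
      intro x hx
      simp only [Finset.mem_insert, Finset.mem_singleton, Finset.mem_inter] at hx ⊢
      tauto
    have h4 := Finset.card_le_card h3
    rw [Finset.card_pair hab] at h4
    omega
  constructor
  · rintro ⟨-, hr, hc⟩
    obtain ⟨T, hT, hT3⟩ := Finset.exists_subset_card_eq (show 3 ≤ F.card from hc)
    have hTL := big F hr T hT hT3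
    have := mem F hr T hTL hT
    rwa [Finset.Subset.antisymm this hT]
  · intro hF
    refine ⟨?_, rk F hF, by rw [card_of_mem_linesM F hF]; norm_num⟩
    rw [Matroid.isFlat_iff_closure_eq]
    apply Set.Subset.antisymm _ (matroidM.subset_closure _ (by simp [hE]))
    have hcl : matroidM.eRk (matroidM.closure F) = 2 := by
      rw [Matroid.eRk_closure_eq, rk F hF]
    obtain ⟨C, hC⟩ : ∃ C : Finset (Fin 13), (C : Set (Fin 13)) = matroidM.closure F :=
      ⟨(Set.toFinite (matroidM.closure F)).toFinset, by simp⟩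
    rw [← hC] at hcl ⊢
    refine Finset.coe_subset.2 (mem C hcl F hF (Finset.coe_subset.1 ?_))
    rw [hC]
    exact matroidM.subset_closure _ (by simp [hE])

/-! Let `F` be the span of the short relations and let `P i` be the class of the `i`-th basis vector
in `K^A / F`. The forms give a map `φ` from this quotient to `V*`, and every dependency among three
forms already holds among the corresponding `P i`. Since the forms 9, 0, 1 are independent,
formality follows once `P 9`, `P 0`, `P 1` span the quotient (`shortRelationSpace_eq_of_mem_span`).
Nine of the fifteen lines build all points from 9, 0, 1, 2, so only `P 2` is in question
(`mem_span_of_lift_lines`). After rescaling, three more lines fix parameters of the construction,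
and the last three each give a relation among the `P i` (`mem_span_of_normalized`). If any of these
has a nonzero coefficient at `P 2`, that point lies in the span. If all three coefficients vanish,
the relations force a nonzero scalar `d` to be zero, in every characteristic. -/

section

/-! ### Linear algebra of lifted collinearities -/

variable {K E W : Type*} [Field K] [AddCommGroup E] [Module K E] [AddCommGroup W] [Module K W]

/-- `P, Q, R` satisfy a linear relation with nonzero coefficients. -/
def FullRelation (K : Type*) {E : Type*} [Field K] [AddCommGroup E] [Module K E]
    (P Q R : E) : Prop :=
  ∃ x y z : K, x ≠ 0 ∧ y ≠ 0 ∧ z ≠ 0 ∧ x • P + y • Q + z • R = 0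

/-- The coefficient `p` can be prescribed because `R` may be rescaled. A point already scaled by `p`
can thus serve as the start of the next line, so normalizations chain. -/
theorem FullRelation.exists_smul_eq {P Q R : E} (h : FullRelation K P Q R) {p : K} (hp : p ≠ 0) :
    ∃ r t : K, r ≠ 0 ∧ t ≠ 0 ∧ r • R = p • P + t • Q := by
  obtain ⟨x, y, z, hx, hy, hz, h⟩ := h
  refine ⟨-(p / x * z), p / x * y, by simp [hp, hx, hz], by simp [hp, hx, hy], ?_⟩
  have h1 : p • P = (p / x * x) • P := by rw [div_mul_cancel₀ p hx]
  rw [h1]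
  linear_combination (norm := module) (-(p / x)) • h

theorem FullRelation.smul {P Q R : E} (h : FullRelation K P Q R) {p q r : K}
    (hp : p ≠ 0) (hq : q ≠ 0) (hr : r ≠ 0) : FullRelation K (p • P) (q • Q) (r • R) := by
  obtain ⟨x, y, z, hx, hy, hz, h⟩ := h
  refine ⟨x / p, y / q, z / r, div_ne_zero hx hp, div_ne_zero hy hq, div_ne_zero hz hr, ?_⟩
  simpa only [smul_smul, div_mul_cancel₀ _ hp, div_mul_cancel₀ _ hq, div_mul_cancel₀ _ hr] using h

theorem mem_span_triple_of_smul_eq {P P₁ P₂ P₃ : E} {r a b c : K} (hr : r ≠ 0)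
    (h : r • P = a • P₁ + b • P₂ + c • P₃) : P ∈ Submodule.span K {P₁, P₂, P₃} := by
  rw [← Submodule.smul_mem_iff _ hr, Submodule.mem_span_triple]
  exact ⟨a, b, c, h.symm⟩

/-- A configuration over a realization of `matroidM`, normalized by scaling the points, in which all
collinearities lift, is contained in the span of three of its points. -/
theorem mem_span_of_normalized (φ : E →ₗ[K] W) {P0 P1 P2 P3 P4 P5 P6 P7 P8 P9 P10 P11 P12 : E}
    (hind : ∀ x y z : K, x • φ P9 + y • φ P0 + z • φ P1 = 0 → x = 0 ∧ y = 0 ∧ z = 0)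
    {a b c m s d d' d'' e f : K} (hb : b ≠ 0) (hc : c ≠ 0) (hd : d ≠ 0)
    (h2 : φ P2 = a • φ P9 + b • φ P0 + c • φ P1)
    (h3 : P3 = P9 + P0) (h4 : P4 = P9 + P1) (h7 : P7 = P3 + m • P1) (h12 : P12 = P7 + s • P9)
    (h5 : P5 = P2 + d • P9) (h6 : P6 = P2 + d' • P3) (h8 : P8 = P2 + d'' • P4)
    (h10 : P10 = P8 + e • P9) (h11 : P11 = P6 + f • P9)
    (h047 : FullRelation K P0 P4 P7) (h056 : FullRelation K P0 P5 P6)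
    (h158 : FullRelation K P1 P5 P8) (hA : FullRelation K P8 P11 P12)
    (hB : FullRelation K P6 P10 P12) (hC : FullRelation K P10 P11 P7) :
    P2 ∈ Submodule.span K {P9, P0, P1} := by
  subst h3 h4 h7 h12 h5 h6 h8 h10 h11
  obtain rfl : m = 1 := by
    obtain ⟨x, y, z, hx, hy, hz, h⟩ := h047
    replace h := congrArg φ h
    simp only [map_add, map_smul, map_zero] at h
    obtain ⟨e1, -, e3⟩ := hind (y + z) (x + z) (y + z * m) (by linear_combination (norm := module) h)
    exact mul_left_cancel₀ hz (by linear_combination e3 - e1)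
  obtain rfl : d' = d := by
    obtain ⟨x, y, z, hx, hy, hz, h⟩ := h056
    replace h := congrArg φ h
    simp only [map_add, map_smul, map_zero, h2] at h
    obtain ⟨e1, -, e3⟩ := hind (y * (a + d) + z * (a + d')) (x + y * b + z * (b + d'))
      (y * c + z * c) (by linear_combination (norm := module) h)
    exact mul_left_cancel₀ (mul_ne_zero hc hz) (by linear_combination c * e1 - (a + d) * e3)
  obtain rfl : d'' = d' := by
    obtain ⟨x, y, z, hx, hy, hz, h⟩ := h158
    replace h := congrArg φ h
    simp only [map_add, map_smul, map_zero, h2] at h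
    obtain ⟨e1, e2, -⟩ := hind (y * (a + d') + z * (a + d'')) (y * b + z * b)
      (x + y * c + z * (c + d'')) (by linear_combination (norm := module) h)
    exact mul_left_cancel₀ (mul_ne_zero hb hz) (by linear_combination b * e1 - (a + d') * e2)
  rename' d'' => d
  obtain ⟨x, y, z, hx, hy, hz, h⟩ := hA
  obtain ⟨x', y', z', hx', hy', hz', h'⟩ := hB
  obtain ⟨x'', y'', z'', hx'', hy'', hz'', h''⟩ := hC
  -- In each remaining relation the first two points are `P2` plus a vector of the span of `P9`,
  -- `P0`, `P1`, and the third lies in that span. Hence the coefficient of `P2` is the sum of the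
  -- first two scalars.
  by_cases hs : x + y = 0
  swap
  · exact mem_span_triple_of_smul_eq (a := -(x * d + y * (d + f) + z * (1 + s)))
      (b := -(y * d + z)) (c := -(x * d + z)) hs (by linear_combination (norm := module) h)
  by_cases hs' : x' + y' = 0
  swap
  · exact mem_span_triple_of_smul_eq (a := -(x' * d + y' * (d + e) + z' * (1 + s)))
      (b := -(x' * d + z')) (c := -(y' * d + z')) hs' (by linear_combination (norm := module) h')
  by_cases hs'' : x'' + y'' = 0
  swap
  · exact mem_span_triple_of_smul_eq (a := -(x'' * (d + e) + y'' * (d + f) + z''))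
      (b := -(y'' * d + z'')) (c := -(x'' * d + z'')) hs''
      (by linear_combination (norm := module) h'')
  -- With all three sums zero, `P2` cancels from the relations, and `φ` yields equations in `d`,
  -- `e`, `f`, `s` alone.
  exfalso
  obtain rfl : y = -x := by linear_combination hs
  obtain rfl : y' = -x' := by linear_combination hs'
  obtain rfl : y'' = -x'' := by linear_combination hs''
  replace h := congrArg φ h
  replace h' := congrArg φ h'
  replace h'' := congrArg φ h''
  simp only [map_add, map_smul, map_zero, h2] at h h' h''
  obtain ⟨e1, e2, e3⟩ := hind (-x * f + z * (1 + s)) (-x * d + z) (x * d + z)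
    (by linear_combination (norm := module) h)
  obtain ⟨e1', e2', -⟩ := hind (-x' * e + z' * (1 + s)) (x' * d + z') (-x' * d + z')
    (by linear_combination (norm := module) h')
  obtain ⟨e1'', e2'', -⟩ := hind (x'' * (e - f) + z'') (-x'' * d + z'') (x'' * d + z'')
    (by linear_combination (norm := module) h'')
  -- Outside characteristic two this already contradicts `hd`; the equations below cover
  -- characteristic two as well.
  have k0 : 2 * d = 0 := mul_left_cancel₀ hx (by linear_combination e3 - e2)
  have k1 : f = d * (1 + s) := mul_left_cancel₀ hx (by linear_combination (1 + s) * e2 - e1)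
  have k2 : e = -d * (1 + s) :=
    mul_left_cancel₀ hx' (by linear_combination (1 + s) * e2' - e1')
  have k3 : e - f = -d := mul_left_cancel₀ hx'' (by linear_combination e1'' - e2'')
  -- Inserting `k1` and `k2` into `k3` gives `-2d(1 + s) = -d`, whose left side vanishes by `k0`.
  exact hd (by linear_combination k3 - k2 + k1 + (1 + s) * k0)

/-- If all collinearities of a realization of `matroidM` lift along `φ`, then so does its rank. -/
theorem mem_span_of_lift_lines (φ : E →ₗ[K] W) (P : Fin 13 → E)
    (hM : ∀ I : Finset (Fin 13), LinearIndepOn K (φ ∘ P) I ↔ I.card ≤ 3 ∧ I ∉ linesM)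
    (hlift : ∀ i j k (x y z : K), φ (x • P i + y • P j + z • P k) = 0 →
      x • P i + y • P j + z • P k = 0) (i : Fin 13) :
    P i ∈ Submodule.span K {P 9, P 0, P 1} := by
  have triple : ∀ i j k : Fin 13, i ≠ j → i ≠ k → j ≠ k → {i, j, k} ∉ linesM →
      ∀ x y z : K, x • φ (P i) + y • φ (P j) + z • φ (P k) = 0 → x = 0 ∧ y = 0 ∧ z = 0 := by
    intro i j k hij hik hjk hL x y z h
    have hI := (hM {i, j, k}).2 ⟨(Finset.card_eq_three.2 ⟨i, j, k, hij, hik, hjk, rfl⟩).le, hL⟩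
    rw [linearIndepOn_finset_iff] at hI
    have := hI (fun l => if l = i then x else if l = j then y else z) (by
      rw [Finset.sum_insert (by simp [hij, hik]), Finset.sum_insert (by simp [hjk]),
        Finset.sum_singleton]
      simpa [hij.symm, hik.symm, hjk.symm, add_assoc] using h)
    simpa [hij.symm, hik.symm, hjk.symm] using this
  have pair : ∀ i j : Fin 13, i ≠ j → ∀ x y : K, x • φ (P i) + y • φ (P j) = 0 →
      x = 0 ∧ y = 0 := by
    intro i j hij x y h
    have hI := (hM {i, j}).2 ⟨by rw [Finset.card_pair hij]; norm_num, fun h => by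
      have h1 := card_of_mem_linesM _ h
      rw [Finset.card_pair hij] at h1
      omega⟩
    rw [linearIndepOn_finset_iff] at hI
    have := hI (fun l => if l = i then x else y) (by
      rw [Finset.sum_pair hij]
      simpa [hij.symm] using h)
    simpa [hij.symm] using this
  have line : ∀ i j k : Fin 13, i ≠ j → i ≠ k → j ≠ k → {i, j, k} ∈ linesM →
      FullRelation K (P i) (P j) (P k) := by
    intro i j k hij hik hjk hL
    have hI : ¬ LinearIndepOn K (φ ∘ P) ({i, j, k} : Finset (Fin 13)) :=
      fun h => ((hM _).1 h).2 hL
    rw [linearIndepOn_finset_iff] at hI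
    push Not at hI
    obtain ⟨g, hg, l, hl, hl0⟩ := hI
    rw [Finset.sum_insert (by simp [hij, hik]), Finset.sum_insert (by simp [hjk]),
      Finset.sum_singleton, ← add_assoc] at hg
    simp only [Function.comp_apply] at hg
    simp only [Finset.mem_insert, Finset.mem_singleton] at hl
    -- A vanishing coefficient would leave a dependency between two points, against simplicity.
    have hi : g i ≠ 0 := by
      intro h0
      obtain ⟨h1, h2⟩ := pair j k hjk (g j) (g k) (by simpa [h0] using hg)
      rcases hl with rfl | rfl | rfl <;> contradiction
    have hj : g j ≠ 0 := fun h0 => hi (pair i k hik (g i) (g k) (by simpa [h0] using hg)).1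
    have hk : g k ≠ 0 := fun h0 => hi (pair i j hij (g i) (g j) (by simpa [h0] using hg)).1
    exact ⟨g i, g j, g k, hi, hj, hk, hlift i j k _ _ _ (by simpa using hg)⟩
  obtain ⟨a, b, c, h2⟩ : ∃ a b c : K,
      φ (P 2) = a • φ (P 9) + b • φ (P 0) + c • φ (P 1) := by
    have hI : ¬ LinearIndepOn K (φ ∘ P) ({2, 9, 0, 1} : Finset (Fin 13)) :=
      fun h => absurd ((hM _).1 h).1 (by decide)
    rw [linearIndepOn_finset_iff] at hI
    push Not at hI
    obtain ⟨g, hg, l, hl, hl0⟩ := hI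
    rw [Finset.sum_insert (by decide), Finset.sum_insert (by decide),
      Finset.sum_insert (by decide), Finset.sum_singleton] at hg
    simp only [Function.comp_apply] at hg
    simp only [Finset.mem_insert, Finset.mem_singleton] at hl
    have hg2 : g 2 ≠ 0 := by
      intro h0
      obtain ⟨h1, h2, h3⟩ := triple 9 0 1 (by decide) (by decide) (by decide) (by decide)
        (g 9) (g 0) (g 1) (by simpa [h0, add_assoc] using hg)
      rcases hl with rfl | rfl | rfl | rfl <;> contradiction
    refine ⟨-((g 2)⁻¹ * g 9), -((g 2)⁻¹ * g 0), -((g 2)⁻¹ * g 1), ?_⟩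
    have h1 : φ (P 2) = ((g 2)⁻¹ * g 2) • φ (P 2) := by rw [inv_mul_cancel₀ hg2, one_smul]
    rw [h1]
    linear_combination (norm := module) (g 2)⁻¹ • hg
  -- Point 2 lies neither on the line through 9 and 1 nor on the line through 9 and 0.
  have hb : b ≠ 0 := by
    rintro rfl
    exact one_ne_zero (triple 2 9 1 (by decide) (by decide) (by decide) (by decide) 1 (-a) (-c)
      (by linear_combination (norm := module) h2)).1
  have hc : c ≠ 0 := by
    rintro rfl
    exact one_ne_zero (triple 2 9 0 (by decide) (by decide) (by decide) (by decide) 1 (-a) (-b)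
      (by linear_combination (norm := module) h2)).1
  have h901 := triple 9 0 1 (by decide) (by decide) (by decide) (by decide)
  replace line : ∀ i j k : Fin 13, (i ≠ j ∧ i ≠ k ∧ j ≠ k ∧ {i, j, k} ∈ linesM) →
      FullRelation K (P i) (P j) (P k) := fun i j k h => line i j k h.1 h.2.1 h.2.2.1 h.2.2.2
  -- Nine lines construct the remaining points from 9, 0, 1, 2. The factors `r0` and `r1` rescale `P
  -- 0` and `P 1` so that points 3 and 4 become plain sums; the later coefficients at rescaled
  -- points are divided accordingly.
  obtain ⟨r3, r0, n3, n0, h3⟩ := (line 9 0 3 (by decide)).exists_smul_eq one_ne_zero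
  obtain ⟨r4, r1, n4, n1, h4⟩ := (line 9 1 4 (by decide)).exists_smul_eq one_ne_zero
  obtain ⟨r7, m, n7, -, h7⟩ := (line 3 1 7 (by decide)).exists_smul_eq n3
  obtain ⟨r12, s, n12, -, h12⟩ := (line 7 9 12 (by decide)).exists_smul_eq n7
  obtain ⟨r5, d, n5, nd, h5⟩ := (line 2 9 5 (by decide)).exists_smul_eq one_ne_zero
  obtain ⟨r6, d', n6, -, h6⟩ := (line 2 3 6 (by decide)).exists_smul_eq one_ne_zero
  obtain ⟨r8, d'', n8, -, h8⟩ := (line 2 4 8 (by decide)).exists_smul_eq one_ne_zero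
  obtain ⟨r10, e, n10, -, h10⟩ := (line 8 9 10 (by decide)).exists_smul_eq n8
  obtain ⟨r11, f, n11, -, h11⟩ := (line 6 9 11 (by decide)).exists_smul_eq n6
  rw [one_smul] at h3 h4 h5 h6 h8
  have key : P 2 ∈ Submodule.span K {P 9, r0 • P 0, r1 • P 1} := by
    refine mem_span_of_normalized φ (P3 := r3 • P 3) (P4 := r4 • P 4) (P5 := r5 • P 5)
      (P6 := r6 • P 6) (P7 := r7 • P 7) (P8 := r8 • P 8) (P10 := r10 • P 10)
      (P11 := r11 • P 11) (P12 := r12 • P 12) (a := a) (b := b / r0) (c := c / r1)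
      (m := m / r1) (s := s) (d := d) (d' := d' / r3) (d'' := d'' / r4) (e := e) (f := f)
      ?_ (div_ne_zero hb n0) (div_ne_zero hc n1) nd ?_ h3 h4 ?_ h12 h5 ?_ ?_ h10 h11
      ((line 0 4 7 (by decide)).smul n0 n4 n7) ((line 0 5 6 (by decide)).smul n0 n5 n6)
      ((line 1 5 8 (by decide)).smul n1 n5 n8) ((line 8 11 12 (by decide)).smul n8 n11 n12)
      ((line 6 10 12 (by decide)).smul n6 n10 n12) ((line 10 11 7 (by decide)).smul n10 n11 n7)
    · intro x y z h
      have := h901 x (y * r0) (z * r1) (by simpa only [map_smul, smul_smul] using h)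
      simpa [n0, n1] using this
    · simpa only [map_smul, smul_smul, div_mul_cancel₀ _ n0, div_mul_cancel₀ _ n1] using h2
    · rw [smul_smul, div_mul_cancel₀ _ n1, h7]
    · rw [smul_smul, div_mul_cancel₀ _ n3, h6]
    · rw [smul_smul, div_mul_cancel₀ _ n4, h8]
  set T := Submodule.span K {P 9, P 0, P 1}
  have t9 : P 9 ∈ T := Submodule.subset_span (by simp)
  have t0 : P 0 ∈ T := Submodule.subset_span (by simp)
  have t1 : P 1 ∈ T := Submodule.subset_span (by simp)
  have t2 : P 2 ∈ T := by
    refine Submodule.span_le.2 ?_ key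
    rintro _ (rfl | rfl | rfl)
    exacts [t9, T.smul_mem _ t0, T.smul_mem _ t1]
  have third : ∀ {r x y : K} {A B C : E}, r ≠ 0 → r • A = x • B + y • C → B ∈ T → C ∈ T →
      A ∈ T := fun hr h hB hC => (T.smul_mem_iff hr).1
    (h ▸ T.add_mem (T.smul_mem _ hB) (T.smul_mem _ hC))
  rw [← one_smul K (P 9)] at h3 h4
  rw [← one_smul K (P 2)] at h5 h6 h8
  -- The same nine lines now propagate membership in `T` to all points.
  have t3 := third n3 h3 t9 t0
  have t4 := third n4 h4 t9 t1
  have t7 := third n7 h7 t3 t1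
  have t12 := third n12 h12 t7 t9
  have t5 := third n5 h5 t2 t9
  have t6 := third n6 h6 t2 t3
  have t8 := third n8 h8 t2 t4
  have t10 := third n10 h10 t8 t9
  have t11 := third n11 h11 t6 t9
  fin_cases i
  exacts [t0, t1, t2, t3, t4, t5, t6, t7, t8, t9, t10, t11, t12]

end

/-! ### From arrangements to the linear algebra -/

namespace HyperplaneArrangement

variable {K V : Type*} [Field K] [AddCommGroup V] [Module K V]

/-- Forms with the same kernel are proportional; the factor is the ratio of their values at any `x`
off the hyperplane. -/
theorem IsDefiningForms.exists_units_smul_eq {A : HyperplaneArrangement K V}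
    {α β : A.hyperplanes → Module.Dual K V} (hα : A.IsDefiningForms α)
    (hβ : A.IsDefiningForms β) : ∃ c : A.hyperplanes → Kˣ, β = c • α := by
  have h : ∀ H, ∃ c : Kˣ, β H = c • α H := by
    intro H
    have hk : LinearMap.ker (α H) = LinearMap.ker (β H) := (hα H).trans (hβ H).symm
    have hne : β H ≠ 0 := by
      intro h0
      have h1 := hβ H
      rw [h0, LinearMap.ker_zero] at h1
      exact (A.isCoatom H H.2).1 h1.symm
    obtain ⟨x, hx⟩ : ∃ x, α H x ≠ 0 := by
      by_contra! hx
      exact hne (LinearMap.ext fun x => by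
        have : x ∈ LinearMap.ker (β H) := hk ▸ hx x
        simpa using this)
    have hx' : β H x ≠ 0 := fun h => hx (by
      have : x ∈ LinearMap.ker (α H) := hk ▸ h
      exact this)
    refine ⟨Units.mk0 (β H x / α H x) (div_ne_zero hx' hx), LinearMap.ext fun w => ?_⟩
    have hw : w - (α H w / α H x) • x ∈ LinearMap.ker (β H) := by
      rw [← hk, LinearMap.mem_ker]
      simp [hx]
    rw [LinearMap.mem_ker] at hw
    simp only [map_sub, map_smul, smul_eq_mul] at hw
    simp only [Units.smul_def, Units.val_mk0, LinearMap.smul_apply, smul_eq_mul]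
    linear_combination hw
  choose c hc using h
  exact ⟨c, funext hc⟩

theorem shortRelationSpace_le (A : HyperplaneArrangement K V)
    (α : A.hyperplanes → Module.Dual K V) : A.shortRelationSpace α ≤ A.relationSpace α :=
  Submodule.span_le.2 fun _ h => h.1

/-- If, modulo the short relations, the basis vectors are spanned by three of them whose forms are
independent, then the short relations are all relations. -/
theorem shortRelationSpace_eq_of_mem_span {A : HyperplaneArrangement K V}
    {α : A.hyperplanes → Module.Dual K V} {H₁ H₂ H₃ : A.hyperplanes}
    (hind : ∀ x y z : K, x • α H₁ + y • α H₂ + z • α H₃ = 0 → x = 0 ∧ y = 0 ∧ z = 0)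
    (hspan : ∀ H, (A.shortRelationSpace α).mkQ (Finsupp.single H 1) ∈ Submodule.span K
      {(A.shortRelationSpace α).mkQ (Finsupp.single H₁ 1),
        (A.shortRelationSpace α).mkQ (Finsupp.single H₂ 1),
        (A.shortRelationSpace α).mkQ (Finsupp.single H₃ 1)}) :
    A.shortRelationSpace α = A.relationSpace α := by
  refine le_antisymm (A.shortRelationSpace_le α) fun w hw => ?_
  have hmem : ∀ w : A.hyperplanes →₀ K, (A.shortRelationSpace α).mkQ w ∈ Submodule.span K
      {(A.shortRelationSpace α).mkQ (Finsupp.single H₁ 1),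
        (A.shortRelationSpace α).mkQ (Finsupp.single H₂ 1),
        (A.shortRelationSpace α).mkQ (Finsupp.single H₃ 1)} := by
    intro w
    induction w using Finsupp.induction_linear with
    | zero => simp
    | add f g hf hg => rw [map_add]; exact add_mem hf hg
    | single H r =>
      rw [← mul_one r, ← smul_eq_mul, ← Finsupp.smul_single, map_smul]
      exact Submodule.smul_mem _ _ (hspan H)
  obtain ⟨x, y, z, h⟩ := Submodule.mem_span_triple.1 (hmem w)
  rw [← map_smul, ← map_smul, ← map_smul, ← map_add, ← map_add, ← sub_eq_zero, ← map_sub,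
    ← LinearMap.mem_ker, Submodule.ker_mkQ] at h
  -- The difference of `w` and a combination of three basis vectors is a short relation. As `w` is
  -- itself a relation, so is the combination, and `hind` makes it zero.
  have h1 := A.shortRelationSpace_le α h
  rw [relationSpace, LinearMap.mem_ker] at h1 hw
  rw [map_sub, hw] at h1
  obtain ⟨rfl, rfl, rfl⟩ := hind x y z (by simpa using h1)
  simpa using h

/-- The support has at most three elements even if hyperplanes coincide or coefficients vanish, so
every such relation lifts to the quotient. -/
theorem add_smul_single_mem_shortRelationSpace {A : HyperplaneArrangement K V}
    {α : A.hyperplanes → Module.Dual K V} {H₁ H₂ H₃ : A.hyperplanes} {x y z : K}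
    (h : x • α H₁ + y • α H₂ + z • α H₃ = 0) :
    x • Finsupp.single H₁ 1 + y • Finsupp.single H₂ 1 + z • Finsupp.single H₃ 1 ∈
      A.shortRelationSpace α := by
  classical
  refine Submodule.subset_span ⟨?_, ?_⟩
  · rw [relationSpace, LinearMap.mem_ker]
    simpa using h
  · simp only [Finsupp.smul_single, smul_eq_mul, mul_one]
    refine (Finset.card_le_card (t := {H₁, H₂, H₃}) ?_).trans Finset.card_le_three
    intro H hH
    by_contra hn
    simp only [Finset.mem_insert, Finset.mem_singleton, not_or] at hn
    simp [Ne.symm hn.1, Ne.symm hn.2.1, Ne.symm hn.2.2] at hH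

/-- `Realizes` supplies one system of forms while `IsFormal` quantifies over all of them; rescaling
by units preserves independence. -/
theorem Realizes.exists_equiv {A : HyperplaneArrangement K V} (hA : A.Realizes matroidM)
    {β : A.hyperplanes → Module.Dual K V} (hβ : A.IsDefiningForms β) :
    ∃ e : Fin 13 ≃ A.hyperplanes, ∀ I : Finset (Fin 13),
      LinearIndepOn K (β ∘ e) (I : Set (Fin 13)) ↔ I.card ≤ 3 ∧ I ∉ linesM := by
  obtain ⟨α, hα, e, he⟩ := hA
  obtain ⟨c, rfl⟩ := hα.exists_units_smul_eq hβ
  refine ⟨e, fun I => ?_⟩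
  have h1 : LinearIndepOn K ((c • α) ∘ e) (I : Set (Fin 13)) ↔
      LinearIndepOn K (α ∘ e) (I : Set (Fin 13)) :=
    LinearIndependent.units_smul_iff (fun i : (I : Set (Fin 13)) => α (e i)) (fun i => c (e i))
  rw [h1, ← matroidM_indep_iff]
  have h2 : LinearIndepOn K (α ∘ e) (I : Set (Fin 13)) ↔ LinearIndepOn K α (e '' I) :=
    linearIndependent_equiv (f := fun H : e '' I => α H) (e.image I)
  rw [h2, ← linearMatroid_indep_iff, he]
  simp

end HyperplaneArrangement

/-- Every hyperplane arrangement, over any field, whose underlying matroid is `matroidM` is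
formal. -/
theorem corollary3p3 {K : Type*} [Field K] {V : Type*} [AddCommGroup V] [Module K V]
    [FiniteDimensional K V] (A : HyperplaneArrangement K V) (hA : A.Realizes matroidM) :
    A.IsFormal := by
  intro α hα
  obtain ⟨e, he⟩ := hA.exists_equiv hα
  let φ : ((A.hyperplanes →₀ K) ⧸ A.shortRelationSpace α) →ₗ[K] Module.Dual K V :=
    (A.shortRelationSpace α).liftQ (Finsupp.linearCombination K α) (A.shortRelationSpace_le α)
  let P : Fin 13 → (A.hyperplanes →₀ K) ⧸ A.shortRelationSpace α :=
    fun i => (A.shortRelationSpace α).mkQ (Finsupp.single (e i) 1)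
  have hφ : ∀ i, φ (P i) = α (e i) := fun i => by
    rw [show φ (P i) = Finsupp.linearCombination K α (Finsupp.single (e i) 1) from rfl]
    simp
  have hφP : φ ∘ P = α ∘ e := funext hφ
  have hspan := mem_span_of_lift_lines φ P (by rwa [hφP]) (by
    intro i j k x y z h
    simp only [map_add, map_smul, hφ] at h
    have := HyperplaneArrangement.add_smul_single_mem_shortRelationSpace h
    rw [← Submodule.ker_mkQ (A.shortRelationSpace α), LinearMap.mem_ker] at this
    simpa only [map_add, map_smul] using this)
  refine HyperplaneArrangement.shortRelationSpace_eq_of_mem_span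
    (H₁ := e 9) (H₂ := e 0) (H₃ := e 1) ?_ fun H => ?_
  · intro x y z h
    have hI := (he {9, 0, 1}).2 (by decide)
    rw [linearIndepOn_finset_iff] at hI
    -- The entries `y`, `z`, `x` stand at the positions 0, 1, 9.
    have := hI ![y, z, 0, 0, 0, 0, 0, 0, 0, x, 0, 0, 0] (by
      rw [Finset.sum_insert (by decide), Finset.sum_insert (by decide), Finset.sum_singleton]
      simpa [add_assoc] using h)
    simpa using this
  · obtain ⟨i, rfl⟩ := e.surjective H
    exact hspan i
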